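/- Let $\mathbf U(\infty)=\mathbf U_\upsilon(\mathfrak{gl}_\infty)$ be the $\mathbb Q(\upsilon)$-algebra with generators $E_i,F_i,K_i,K_i^{-1}$ $(i\in\mathbb Z)$ and relations, for all $i,j\in\mathbb Z$, (a) $K_iK_j=K_jK_i$, $K_iK_i^{-1}=K_i^{-1}K_i=1$; (b) $K_iE_j=\upsilon^{\delta_{i,j}-\delta_{i,j+1}}E_jK_i$; (c) $K_iF_j=\upsilon^{\delta_{i,j+1}-\delta_{i,j}}F_jK_i$; (d) $E_iE_j=E_jE_i$ and $F_iF_j=F_jF_i$ if $|i-j|>1$; (e) $E_iF_j-F_jE_i=\delta_{i,j}\dfrac{\widetilde K_i-\widetilde K_i^{-1}}{\upsilon-\upsilon^{-1}}$, where $\widetilde K_i=K_iK_{i+1}^{-1}$; (f) $E_i^2E_j-(\upsilon+\upsilon^{-1})E_iE_jE_i+E_jE_i^2=0$ if $|i-j|=1$; (g) $F_i^2F_j-(\upsilon+\upsilon^{-1})F_iF_jF_i+F_jF_i^2=0$ if $|i-j|=1$. Let $X(\infty)=\prod_{i\in\mathbb Z}\mathbb Z$. Let $\alpha_i\in X(\infty)$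 be the sequence with $1$ in position $i$, $-1$ in position $i+1$ and $0$ elsewhere. Write $\mu\le_{\rm wt}\lambda$ if $\lambda-\mu$ is a finite sum of elements $\alpha_i$ (repetitions and the empty sum allowed). For a left $\mathbf U(\infty)$-module $M$ and $\lambda\in X(\infty)$ let $M_\lambda=\{x\in M: K_ix=\upsilon^{\lambda_i}x\ \text{for all } i\in\mathbb Z\}$. The module $M$ is a weight module if $M=\bigoplus_{\lambda\in X(\infty)}M_\lambda$. Let $\mathcal C^{hi}$ be the full subcategory of $\mathbf U(\infty)$-modules whose objects are the weight modules $M$ such that for every $x\in M$ there is $n_0\ge 1$ with $E_{i_1}\cdots E_{i_n}x=0$ for all $n\ge n_0$ and all $i_1,\dots,i_n\in\mathbb Z$. Let $\mathcal O$ be the full subcategory whose objects are the weight modules $M$ such that every $M_\lambda$ is finite dimensional over $\mathbb Q(\upsilon)$ and there are finitely many $\lambda^{(1)},\dots,\lambda^{(s)}\in X(\infty)$ such that every $\mu$ with $M_\mu\ne0$ satisfies $\mu\le_{\rm wt}\lambda^{(k)}$ for some $k$. For $\lambda\in X(\infty)$ let $M(\lambda)=\mathbf U(\infty)\big/\big(\sum_{i\in\mathbb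 Z}\mathbf U(\infty)E_i+\sum_{i\in\mathbb Z}\mathbf U(\infty)(K_i-\upsilon^{\lambda_i})\big)$ be the Verma module. Theorem. For every $\lambda\in X(\infty)$ the module $M(\lambda)$ has a unique maximal submodule, namely the sum of all its proper submodules. Let $L(\lambda)$ be the corresponding irreducible quotient of $M(\lambda)$. Then: (1) The map $\lambda\mapsto L(\lambda)$ defines a bijection between $X(\infty)$ and the set of isomorphism classes of irreducible $\mathbf U(\infty)$-modules that belong to the category $\mathcal C^{hi}$. (2) The map $\lambda\mapsto L(\lambda)$ defines a bijection between $X(\infty)$ and the set of isomorphism classes of irreducible $\mathbf U(\infty)$-modules that belong to the category $\mathcal O$. -/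

import Mathlib

universe w

namespace QuantumGL

noncomputable section

open CategoryTheory

/-! ### The quantum group `U(∞) = U_υ(gl_∞)` -/

/-- The ground field `ℚ(υ)`. -/
abbrev BaseField : Type := RatFunc ℚ

/-- The indeterminate `υ` of `ℚ(υ)`. -/
def ups : BaseField := RatFunc.X

/-- The generators `E i`, `F i`, `K i`, `(K i)⁻¹` for `i ∈ ℤ`. -/
inductive Gen : Type
  | E (i : ℤ)
  | F (i : ℤ)
  | K (i : ℤ)
  | Kinv (i : ℤ)

/-- The Kronecker delta, with integer values. -/
def delta (i j : ℤ) : ℤ := if i = j then 1 else 0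

/-- The free `ℚ(υ)`-algebra on the generators. -/
abbrev FreeAlg : Type := FreeAlgebra BaseField Gen

namespace FreeAlg

/-- The free generator `E i`. -/
def E (i : ℤ) : FreeAlg := FreeAlgebra.ι BaseField (Gen.E i)

/-- The free generator `F i`. -/
def F (i : ℤ) : FreeAlg := FreeAlgebra.ι BaseField (Gen.F i)

/-- The free generator `K i`. -/
def K (i : ℤ) : FreeAlg := FreeAlgebra.ι BaseField (Gen.K i)

/-- The free generator that becomes the inverse of `K i`. -/
def Kinv (i : ℤ) : FreeAlg := FreeAlgebra.ι BaseField (Gen.Kinv i)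

end FreeAlg

open FreeAlg in
/-- The defining relations of `U_υ(gl_∞)`. -/
inductive Rel : FreeAlg → FreeAlg → Prop
  | K_comm (i j : ℤ) : Rel (K i * K j) (K j * K i)
  | K_mul_Kinv (i : ℤ) : Rel (K i * Kinv i) 1
  | Kinv_mul_K (i : ℤ) : Rel (Kinv i * K i) 1
  | K_E (i j : ℤ) : Rel (K i * E j) (ups ^ (delta i j - delta i (j + 1)) • (E j * K i))
  | K_F (i j : ℤ) : Rel (K i * F j) (ups ^ (delta i (j + 1) - delta i j) • (F j * K i))
  | E_comm (i j : ℤ) (h : 1 < |i - j|) : Rel (E i * E j) (E j * E i)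
  | F_comm (i j : ℤ) (h : 1 < |i - j|) : Rel (F i * F j) (F j * F i)
  | E_F (i : ℤ) : Rel (E i * F i - F i * E i)
      ((ups - ups⁻¹)⁻¹ • (K i * Kinv (i + 1) - K (i + 1) * Kinv i))
  | E_F_ne (i j : ℤ) (h : i ≠ j) : Rel (E i * F j - F j * E i) 0
  | E_serre (i j : ℤ) (h : |i - j| = 1) :
      Rel (E i ^ 2 * E j - (ups + ups⁻¹) • (E i * E j * E i) + E j * E i ^ 2) 0
  | F_serre (i j : ℤ) (h : |i - j| = 1) :
      Rel (F i ^ 2 * F j - (ups + ups⁻¹) • (F i * F j * F i) + F j * F i ^ 2) 0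

/-- The algebra `U(∞) = U_υ(gl_∞)` over `ℚ(υ)`. -/
abbrev U : Type := RingQuot Rel

/-- The element `E i` of `U(∞)`. -/
def U.E (i : ℤ) : U := RingQuot.mkAlgHom BaseField Rel (FreeAlg.E i)

/-- The element `F i` of `U(∞)`. -/
def U.F (i : ℤ) : U := RingQuot.mkAlgHom BaseField Rel (FreeAlg.F i)

/-- The element `K i` of `U(∞)`. -/
def U.K (i : ℤ) : U := RingQuot.mkAlgHom BaseField Rel (FreeAlg.K i)

/-! ### Weights -/

/-- The set of weights `X(∞) = ∏_{i ∈ ℤ} ℤ` (arbitrary integer sequences). -/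
abbrev Weight : Type := ℤ → ℤ

/-- The simple root `α_i = e_i - e_{i+1}`. -/
def simpleRoot (i : ℤ) : Weight := Pi.single i 1 - Pi.single (i + 1) 1

/-- `μ ≤_wt lam`: the difference `lam - μ` is a finite sum of simple roots. -/
def WtLE (μ lam : Weight) : Prop :=
  lam - μ ∈ AddSubmonoid.closure (Set.range simpleRoot)

section Modules

variable (M : Type w) [AddCommGroup M] [Module BaseField M] [Module U M]
  [IsScalarTower BaseField U M]

/-- The weight space `M_lam`. -/
def weightSpace (lam : Weight) : Submodule BaseField M where
  carrier := {x | ∀ i, U.K i • x = ups ^ lam i • x}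
  zero_mem' := fun i => by simp
  add_mem' := fun hx hy i => by rw [smul_add, smul_add, hx i, hy i]
  smul_mem' := fun c x hx i => by rw [smul_algebra_smul_comm, hx i, smul_comm]

/-- The set `wt(M)` of weights of `M`. -/
def weights : Set Weight := {lam | weightSpace M lam ≠ ⊥}

open Classical in
/-- `M` is a weight module: it is the direct sum of its weight spaces. -/
def IsWeightModule : Prop := DirectSum.IsInternal (weightSpace M)

/-- `M` is a weight module and every vector is killed by all monomials in the `E i` of
sufficiently large degree. -/
def IsHi : Prop :=
  IsWeightModule M ∧
    ∀ x : M, ∃ n₀ : ℕ, 1 ≤ n₀ ∧ ∀ l : List ℤ, n₀ ≤ l.length → (l.map U.E).prod • x = 0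

/-- `M` is a weight module with finite dimensional weight spaces, whose weights lie below
finitely many weights. -/
def IsO : Prop :=
  IsWeightModule M ∧
    (∀ lam, FiniteDimensional BaseField (weightSpace M lam)) ∧
    ∃ s : Finset Weight, ∀ μ ∈ weights M, ∃ lam ∈ s, WtLE μ lam

end Modules

/-! ### The categories, as full subcategories of the category of left `U(∞)`-modules -/

section Categories

open scoped ModuleCat

/-- The full subcategory `C^hi` of `U(∞)-Mod`. -/
def catHi : ObjectProperty (ModuleCat.{w} U) := fun M => IsHi M

/-- The full subcategory `O` of `U(∞)-Mod`. -/
def catO : ObjectProperty (ModuleCat.{w} U) := fun M => IsO M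

end Categories

/-- The isomorphism class of a left `U(∞)`-module. -/
def isoClass (M : ModuleCat.{w} U) : Quotient (isIsomorphicSetoid (ModuleCat.{w} U)) :=
  Quotient.mk _ M

/-- The set of isomorphism classes of irreducible `U(∞)`-modules that belong to the full
subcategory `P`. -/
def irreducibleClasses (P : ObjectProperty (ModuleCat.{w} U)) :
    Set (Quotient (isIsomorphicSetoid (ModuleCat.{w} U))) :=
  {c | ∃ M : ModuleCat.{w} U, P M ∧ IsSimpleModule U M ∧ isoClass M = c}

/-! ### Verma modules and their irreducible quotients -/

/-- The left ideal `∑ U E_i + ∑ U (K_i - υ^{lam i})`. -/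
def vermaIdeal (lam : Weight) : Submodule U U :=
  Submodule.span U
    (Set.range U.E ∪ Set.range fun i => U.K i - algebraMap BaseField U (ups ^ lam i))

/-- The Verma module `M(lam)`. -/
abbrev Verma (lam : Weight) : Type := U ⧸ vermaIdeal lam

/-- The sum of all proper submodules of `M(lam)`; it is the unique maximal submodule. -/
def vermaRadical (lam : Weight) : Submodule U (Verma lam) := sSup {N | N ≠ ⊤}

/-- The irreducible quotient `L(lam)` of `M(lam)`. -/
abbrev LType (lam : Weight) : Type := Verma lam ⧸ vermaRadical lam

/-- `L(lam)` as an object of `U(∞)-Mod` (lifted to an arbitrary universe). -/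
def L (lam : Weight) : ModuleCat.{w} U := ModuleCat.of U (ULift.{w} (LType lam))

end

end QuantumGL

namespace QuantumGL

noncomputable section

open CategoryTheory

/-! ### The base field -/

/-! A module generated by a highest weight vector `x` of weight `lam` is spanned by the vectors `F_w
x`, because each `E i` can be moved to the right until it kills `x`. The simple roots are linearly
independent, so only finitely many words have a given weight and only the empty word has weight `0`.
Hence such a module lies in `O`, and its `lam`-weight space is the line through `x`. A submodule
contains the weight components of its elements, so a proper one has no component on that line. The
same then holds for the sum of all proper submodules, which is therefore proper as soon as `x ≠ 0`.

The serious point is that the generator of `M(lam)` is nonzero. No triangular decomposition is used: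
`F i` acts on the space of all words by adding a letter, and `E i` by the rule that the commutation
relations force. The relations among the `E i` hold there exactly. Those among the `F i` hold modulo
the radical, the vectors from which no word in the `E i` reaches the empty word. The quotient is a
`U(∞)`-module with a nonzero vector annihilated by `vermaIdeal lam`.

For the classification, `O` is contained in `C^hi`. In a nonzero object of `C^hi`, a longest
nonvanishing monomial in the `E i` applied to a weight vector yields a highest weight vector, so an
irreducible object is some `L(lam)`. The weight `lam` is recovered as the largest weight for `≤_wt`.
-/

lemma ups_ne_zero : ups ≠ 0 := RatFunc.X_ne_zero

lemma ups_pow_ne_one {n : ℕ} (hn : n ≠ 0) : ups ^ n ≠ 1 := by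
  intro h
  have h1 : algebraMap (Polynomial ℚ) (RatFunc ℚ) (Polynomial.X ^ n) =
      algebraMap (Polynomial ℚ) (RatFunc ℚ) 1 := by
    rw [map_pow, RatFunc.algebraMap_X, map_one]; exact h
  have h2 := RatFunc.algebraMap_injective ℚ h1
  have h3 := congrArg Polynomial.natDegree h2
  simp at h3
  exact hn h3

/-- Since `υ` is not a root of unity, the eigenvalues of the `K i` separate weights. -/
lemma ups_zpow_injective : Function.Injective fun n : ℤ => ups ^ n := by
  have key : ∀ n : ℤ, ups ^ n = 1 → n = 0 := by
    intro n hn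
    by_contra h0
    have h1 : ups ^ n.natAbs = 1 := by
      rcases Int.natAbs_eq n with h | h
      · rw [h, zpow_natCast] at hn; exact hn
      · rw [h, zpow_neg, zpow_natCast, inv_eq_one] at hn; exact hn
    exact ups_pow_ne_one (by omega) h1
  intro m n hmn
  have : ups ^ (m - n) = 1 := by
    rw [zpow_sub₀ ups_ne_zero, div_eq_one_iff_eq (zpow_ne_zero _ ups_ne_zero)]; exact hmn
  have := key _ this
  omega

/-! ### Weights of words -/

/-- The sum of the simple roots indexed by the letters of a word. -/
def wordWeight (w : List ℤ) : Weight := (w.map simpleRoot).sum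

@[simp] lemma wordWeight_nil : wordWeight [] = 0 := rfl

@[simp] lemma wordWeight_cons (i : ℤ) (w : List ℤ) :
    wordWeight (i :: w) = simpleRoot i + wordWeight w := by simp [wordWeight]

@[simp] lemma wordWeight_append (u w : List ℤ) :
    wordWeight (u ++ w) = wordWeight u + wordWeight w := by simp [wordWeight]

lemma simpleRoot_apply (i j : ℤ) : simpleRoot i j = delta j i - delta j (i + 1) := by
  simp [simpleRoot, delta, Pi.single_apply]

lemma wordWeight_apply (w : List ℤ) (j : ℤ) :
    wordWeight w j = (w.count j : ℤ) - w.count (j - 1) := by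
  induction w with
  | nil => simp
  | cons i w ih =>
    rw [wordWeight_cons, Pi.add_apply, ih, simpleRoot_apply, List.count_cons, List.count_cons]
    simp only [delta, beq_iff_eq]
    push_cast
    split_ifs <;> omega

/-- This is the linear independence of the simple roots. Coordinate `j` of the weight is the count
of `j` minus the count of `j - 1`, so the difference of the two counts does not depend on `j`. -/
lemma perm_of_wordWeight_eq {u w : List ℤ} (h : wordWeight u = wordWeight w) : u.Perm w := by
  set d : ℤ → ℤ := fun j => (u.count j : ℤ) - w.count j with hd
  have step : ∀ j, d j = d (j - 1) := by
    intro j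
    have := congrFun h j
    rw [wordWeight_apply, wordWeight_apply] at this
    simp only [hd]; omega
  have const : ∀ j, d j = d 0 := by
    intro j
    induction j using Int.induction_on with
    | zero => rfl
    | succ i ih => rw [step, add_sub_cancel_right, ih]
    | pred i ih => rw [← step, ih]
  -- At a letter absent from both words the constant difference is zero.
  obtain ⟨a, ha⟩ := Infinite.exists_notMem_finset (u ++ w).toFinset
  rw [List.mem_toFinset, List.mem_append, not_or] at ha
  have hz : d 0 = 0 := by
    rw [← const a]
    simp [hd, List.count_eq_zero_of_not_mem ha.1, List.count_eq_zero_of_not_mem ha.2]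
  rw [List.perm_iff_count]
  intro j
  have := const j
  rw [hz] at this
  simp only [hd] at this
  omega

lemma finite_wordWeight_eq (μ : Weight) : {w : List ℤ | wordWeight w = μ}.Finite := by
  rcases Set.eq_empty_or_nonempty {w : List ℤ | wordWeight w = μ} with h | ⟨u, hu⟩
  · rw [h]; exact Set.finite_empty
  · refine (List.finite_toSet u.permutations).subset fun w hw => ?_
    exact List.mem_permutations.mpr (perm_of_wordWeight_eq (hw.trans hu.symm))

lemma eq_nil_of_wordWeight_eq_zero {w : List ℤ} (h : wordWeight w = 0) : w = [] :=
  List.perm_nil.mp (perm_of_wordWeight_eq (h.trans wordWeight_nil.symm))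

lemma wtLE_iff {μ lam : Weight} : WtLE μ lam ↔ ∃ w, wordWeight w = lam - μ := by
  constructor
  · intro h
    rw [WtLE] at h
    generalize lam - μ = β at h
    induction h using AddSubmonoid.closure_induction with
    | mem x hx => obtain ⟨i, rfl⟩ := hx; exact ⟨[i], by simp⟩
    | zero => exact ⟨[], rfl⟩
    | add x y _ _ hx hy =>
      obtain ⟨a, rfl⟩ := hx
      obtain ⟨b, rfl⟩ := hy
      exact ⟨a ++ b, by simp⟩
  · rintro ⟨w, hw⟩
    rw [WtLE, ← hw]
    refine AddSubmonoid.list_sum_mem _ fun x hx => ?_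
    obtain ⟨i, -, rfl⟩ := List.mem_map.mp hx
    exact AddSubmonoid.subset_closure ⟨i, rfl⟩

lemma WtLE.antisymm {μ lam : Weight} (h₁ : WtLE μ lam) (h₂ : WtLE lam μ) : μ = lam := by
  obtain ⟨u, hu⟩ := wtLE_iff.mp h₁
  obtain ⟨w, hw⟩ := wtLE_iff.mp h₂
  have h : u ++ w = [] := eq_nil_of_wordWeight_eq_zero (by rw [wordWeight_append, hu, hw]; abel)
  rw [(List.append_eq_nil_iff.mp h).1, wordWeight_nil] at hu
  exact (sub_eq_zero.mp hu.symm).symm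

/-! ### Relations in `U(∞)` -/

/-- The inverse of `K i` in `U(∞)`. -/
def U.Kinv (i : ℤ) : U := RingQuot.mkAlgHom BaseField Rel (FreeAlg.Kinv i)

namespace U

lemma K_mul_Kinv (i : ℤ) : K i * Kinv i = 1 := by
  simpa [K, Kinv] using RingQuot.mkAlgHom_rel BaseField (Rel.K_mul_Kinv i)

lemma Kinv_mul_K (i : ℤ) : Kinv i * K i = 1 := by
  simpa [K, Kinv] using RingQuot.mkAlgHom_rel BaseField (Rel.Kinv_mul_K i)

lemma K_mul_E (i j : ℤ) : K i * E j = ups ^ (simpleRoot j i) • (E j * K i) := by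
  rw [simpleRoot_apply]
  simpa [K, E] using RingQuot.mkAlgHom_rel BaseField (Rel.K_E i j)

lemma K_mul_F (i j : ℤ) : K i * F j = ups ^ (-simpleRoot j i) • (F j * K i) := by
  rw [simpleRoot_apply, neg_sub]
  simpa [K, F] using RingQuot.mkAlgHom_rel BaseField (Rel.K_F i j)

lemma E_mul_F (i : ℤ) : E i * F i = F i * E i +
    (ups - ups⁻¹)⁻¹ • (K i * Kinv (i + 1) - K (i + 1) * Kinv i) := by
  rw [← sub_eq_iff_eq_add']
  simpa [K, E, F, Kinv] using RingQuot.mkAlgHom_rel BaseField (Rel.E_F i)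

lemma E_mul_F_of_ne {i j : ℤ} (h : i ≠ j) : E i * F j = F j * E i := by
  rw [← sub_eq_zero]
  simpa [E, F] using RingQuot.mkAlgHom_rel BaseField (Rel.E_F_ne i j h)

/-- An induction principle: a property of elements of `U(∞)` that holds for scalars and generators
and is stable under sums and products holds for all elements. -/
lemma induction {P : U → Prop} (algebraMap : ∀ c : BaseField, P (algebraMap BaseField U c))
    (E : ∀ i, P (E i)) (F : ∀ i, P (F i)) (K : ∀ i, P (K i)) (Kinv : ∀ i, P (Kinv i))
    (mul : ∀ a b, P a → P b → P (a * b)) (add : ∀ a b, P a → P b → P (a + b)) (u : U) : P u := by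
  obtain ⟨a, rfl⟩ := RingQuot.mkAlgHom_surjective BaseField Rel u
  induction a using FreeAlgebra.induction with
  | grade0 c => rw [AlgHom.commutes]; exact algebraMap c
  | grade1 g =>
    cases g with
    | E i => exact E i
    | F i => exact F i
    | K i => exact K i
    | Kinv i => exact Kinv i
  | mul a b ha hb => rw [map_mul]; exact mul _ _ ha hb
  | add a b ha hb => rw [map_add]; exact add _ _ ha hb

end U

section WordSpan

variable {M : Type w} [AddCommGroup M] [Module BaseField M] [Module U M]

/-- The span over `ℚ(υ)` of the vectors `F_w x`, for the words `w` with a given weight. -/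
def wordSpan (x : M) (β : Weight) : Submodule BaseField M :=
  Submodule.span BaseField ((fun w : List ℤ => (w.map U.F).prod • x) '' {w | wordWeight w = β})

lemma finiteDimensional_wordSpan (x : M) (β : Weight) :
    FiniteDimensional BaseField (wordSpan x β) :=
  FiniteDimensional.span_of_finite _ ((finite_wordWeight_eq β).image _)

lemma wordSpan_zero (x : M) : wordSpan x 0 = Submodule.span BaseField {x} := by
  have : {w : List ℤ | wordWeight w = 0} = {[]} := by
    ext w
    exact ⟨eq_nil_of_wordWeight_eq_zero, fun h => by rw [Set.mem_singleton_iff.mp h]; rfl⟩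
  simp [wordSpan, this]

end WordSpan

/-! ### Weight spaces: action of the generators and independence. -/

section Modules

variable {M : Type w} [AddCommGroup M] [Module BaseField M] [Module U M]
  [IsScalarTower BaseField U M]

lemma Kinv_smul_of_mem_weightSpace {lam : Weight} {x : M} (hx : x ∈ weightSpace M lam) (i : ℤ) :
    U.Kinv i • x = ups ^ (-lam i) • x := by
  have h : U.Kinv i • (U.K i • x) = x := by rw [← mul_smul, U.Kinv_mul_K, one_smul]
  rw [hx i, smul_algebra_smul_comm] at h
  conv_rhs => rw [← h]
  rw [smul_smul, ← zpow_add₀ ups_ne_zero, neg_add_cancel, zpow_zero, one_smul]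

lemma E_smul_mem_weightSpace {lam : Weight} {x : M} (hx : x ∈ weightSpace M lam) (j : ℤ) :
    U.E j • x ∈ weightSpace M (lam + simpleRoot j) := by
  intro i
  rw [← mul_smul, U.K_mul_E, smul_assoc, mul_smul, hx i, smul_algebra_smul_comm, smul_smul,
    ← zpow_add₀ ups_ne_zero, Pi.add_apply, add_comm]

lemma F_smul_mem_weightSpace {lam : Weight} {x : M} (hx : x ∈ weightSpace M lam) (j : ℤ) :
    U.F j • x ∈ weightSpace M (lam - simpleRoot j) := by
  intro i
  rw [← mul_smul, U.K_mul_F, smul_assoc, mul_smul, hx i, smul_algebra_smul_comm, smul_smul,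
    ← zpow_add₀ ups_ne_zero, Pi.sub_apply, sub_eq_neg_add]

lemma E_prod_smul_mem_weightSpace {lam : Weight} {x : M} (hx : x ∈ weightSpace M lam)
    (w : List ℤ) : (w.map U.E).prod • x ∈ weightSpace M (lam + wordWeight w) := by
  induction w with
  | nil => simpa using hx
  | cons i w ih =>
    rw [List.map_cons, List.prod_cons, mul_smul, wordWeight_cons, add_comm (simpleRoot i),
      ← add_assoc]
    exact E_smul_mem_weightSpace ih i

lemma F_prod_smul_mem_weightSpace {lam : Weight} {x : M} (hx : x ∈ weightSpace M lam)
    (w : List ℤ) : (w.map U.F).prod • x ∈ weightSpace M (lam - wordWeight w) := by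
  induction w with
  | nil => simpa using hx
  | cons i w ih =>
    rw [List.map_cons, List.prod_cons, mul_smul, wordWeight_cons, add_comm (simpleRoot i),
      ← sub_sub]
    exact F_smul_mem_weightSpace ih i

/-- A submodule contains the weight components of its elements. -/
lemma mem_of_add_sum_mem (N : Submodule U M) (μ : Weight) (s : Finset Weight) (hs : μ ∉ s) :
    ∀ x ∈ weightSpace M μ, ∀ y : Weight → M, (∀ ν, y ν ∈ weightSpace M ν) →
      x + ∑ ν ∈ s, y ν ∈ N → x ∈ N := by
  classical
  induction s using Finset.induction_on with
  | empty => intro x _ y _ h; simpa using h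
  | insert κ s hκ ih =>
    intro x hx y hy h
    rw [Finset.mem_insert, not_or] at hs
    obtain ⟨i, hi⟩ := Function.ne_iff.mp hs.1
    -- `K i - υ^(κ i)` acts on the weight space of `ν` by `c ν`. It removes the component of weight
    -- `κ` and rescales the one of weight `μ` by a nonzero factor, which reduces the claim to `s`.
    set c : Weight → BaseField := fun ν => ups ^ ν i - ups ^ κ i with hc
    have hcμ : c μ ≠ 0 := fun h0 => hi (ups_zpow_injective (sub_eq_zero.mp h0))
    have smul_mem : ∀ (a : BaseField) {z : M}, z ∈ N → a • z ∈ N := by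
      intro a z hz
      rw [← algebraMap_smul U a z]
      exact N.smul_mem _ hz
    have act : ∀ ν, ∀ z ∈ weightSpace M ν, U.K i • z - ups ^ κ i • z = c ν • z := by
      intro ν z hz
      rw [hz i, ← sub_smul]
    have h1 : U.K i • (x + ∑ ν ∈ insert κ s, y ν) - ups ^ κ i • (x + ∑ ν ∈ insert κ s, y ν) ∈ N :=
      N.sub_mem (N.smul_mem _ h) (smul_mem _ h)
    have h2 : U.K i • (x + ∑ ν ∈ insert κ s, y ν) - ups ^ κ i • (x + ∑ ν ∈ insert κ s, y ν) =
        c μ • x + ∑ ν ∈ s, c ν • y ν := by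
      rw [smul_add, smul_add, add_sub_add_comm, act μ x hx, Finset.smul_sum, Finset.smul_sum,
        ← Finset.sum_sub_distrib, Finset.sum_congr rfl fun ν _ => act ν (y ν) (hy ν),
        Finset.sum_insert hκ, hc]
      simp
    rw [h2] at h1
    have h3 := ih hs.2 (c μ • x) (Submodule.smul_mem _ _ hx) (fun ν => c ν • y ν)
      (fun ν => Submodule.smul_mem _ _ (hy ν)) h1
    have h4 := smul_mem (c μ)⁻¹ h3
    rwa [smul_smul, inv_mul_cancel₀ hcμ, one_smul] at h4

lemma mem_of_add_mem (N : Submodule U M) {μ : Weight} {x y : M} (hx : x ∈ weightSpace M μ)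
    (hy : y ∈ ⨆ ν, ⨆ (_ : ν ≠ μ), weightSpace M ν) (h : x + y ∈ N) : x ∈ N := by
  classical
  obtain ⟨s, f, hf⟩ : ∃ (s : Finset Weight) (f : Weight → M), μ ∉ s ∧
      (∀ ν, f ν ∈ weightSpace M ν) ∧ y = ∑ ν ∈ s, f ν := by
    obtain ⟨f, hf, rfl⟩ := (Submodule.mem_iSup_iff_exists_finsupp _ _).mp hy
    have hfμ : f μ = 0 := by simpa using hf μ
    refine ⟨f.support, f, by simp [hfμ], fun ν => ?_, rfl⟩
    by_cases hν : ν = μ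
    · rw [hν, hfμ]; exact Submodule.zero_mem _
    · simpa [hν] using hf ν
  obtain ⟨hs, hf, rfl⟩ := hf
  exact mem_of_add_sum_mem N μ s hs x hx f hf h

lemma iSupIndep_weightSpace : iSupIndep (weightSpace M) := by
  intro μ
  rw [Submodule.disjoint_def]
  intro x hx hy
  have := mem_of_add_mem (⊥ : Submodule U M) hx (Submodule.neg_mem _ hy) (by simp)
  simpa using this

lemma isWeightModule_iff : IsWeightModule M ↔ ⨆ μ, weightSpace M μ = ⊤ := by
  classical
  rw [IsWeightModule, DirectSum.isInternal_submodule_iff_iSupIndep_and_iSup_eq_top]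
  exact and_iff_right iSupIndep_weightSpace

/-- Modules in `O` belong to `C^hi`. -/
lemma IsO.isHi (h : IsO M) : IsHi M := by
  classical
  refine ⟨h.1, fun x => ?_⟩
  obtain ⟨s, hs⟩ := h.2.2
  have hx : x ∈ ⨆ μ, weightSpace M μ := by rw [isWeightModule_iff.mp h.1]; trivial
  induction hx using Submodule.iSup_induction' with
  | mem μ x hx =>
    have : ∀ κ : Weight, ∃ n : ℕ, ∀ w : List ℤ, wordWeight w = κ - μ → w.length = n := by
      intro κ
      by_cases hκ : ∃ w, wordWeight w = κ - μ
      · obtain ⟨u, hu⟩ := hκ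
        exact ⟨u.length, fun w hw => (perm_of_wordWeight_eq (hw.trans hu.symm)).length_eq⟩
      · exact ⟨0, fun w hw => (hκ ⟨w, hw⟩).elim⟩
    choose f hf using this
    refine ⟨s.sup f + 1, by omega, fun w hw => ?_⟩
    by_contra h0
    have hmem : μ + wordWeight w ∈ weights M := fun hbot => h0 <| by
      have := E_prod_smul_mem_weightSpace hx w
      rwa [hbot, Submodule.mem_bot] at this
    obtain ⟨κ, hκ, hle⟩ := hs _ hmem
    obtain ⟨u, hu⟩ := wtLE_iff.mp hle
    -- The nonzero weight `μ + wordWeight w` lies below `κ`, so `w` extends to a word of weight `κ -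
    -- μ`, whose length is bounded by the supremum of `f`.
    have h1 := hf κ (w ++ u) (by rw [wordWeight_append, hu]; abel)
    have h2 := Finset.le_sup (f := f) hκ
    rw [List.length_append] at h1
    omega
  | zero => exact ⟨1, le_rfl, fun w _ => smul_zero _⟩
  | add x y _ _ hx hy =>
    obtain ⟨m, hm, hx⟩ := hx
    obtain ⟨n, hn, hy⟩ := hy
    exact ⟨max m n, by omega, fun w hw => by
      rw [smul_add, hx w (by omega), hy w (by omega), add_zero]⟩

/-! ### Highest weight modules -/

/-- `x` is a vector of weight `lam`, killed by all `E i`. -/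
structure IsHighestWeightVector (lam : Weight) (x : M) : Prop where
  mem_weightSpace : x ∈ weightSpace M lam
  E_smul : ∀ i, U.E i • x = 0

namespace IsHighestWeightVector

variable {lam : Weight} {x : M}

lemma wordSpan_le (hx : IsHighestWeightVector lam x) (μ : Weight) :
    wordSpan x (lam - μ) ≤ weightSpace M μ := by
  refine Submodule.span_le.mpr ?_
  rintro _ ⟨w, hw, rfl⟩
  have := F_prod_smul_mem_weightSpace hx.mem_weightSpace w
  rwa [show wordWeight w = lam - μ from hw, sub_sub_cancel] at this

/-- Moving `E i` to the right past an equal letter leaves a Cartan term, which is a scalar on the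
weight vector `F_w x`; once past all letters, `E i` kills `x`. -/
lemma E_smul_F_prod_mem (hx : IsHighestWeightVector lam x) (i : ℤ) (w : List ℤ) :
    U.E i • (w.map U.F).prod • x ∈
      Submodule.span BaseField (Set.range fun w : List ℤ => (w.map U.F).prod • x) := by
  induction w with
  | nil => simp [hx.E_smul i]
  | cons j w ih =>
    have hF : ∀ y ∈ Submodule.span BaseField (Set.range fun w : List ℤ => (w.map U.F).prod • x),
        U.F j • y ∈ Submodule.span BaseField (Set.range fun w : List ℤ => (w.map U.F).prod • x) := by
      intro y hy
      induction hy using Submodule.span_induction with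
      | mem y hy =>
        obtain ⟨u, rfl⟩ := hy
        exact Submodule.subset_span ⟨j :: u, by simp [mul_smul]⟩
      | zero => simp
      | add y z _ _ hy hz => rw [smul_add]; exact Submodule.add_mem _ hy hz
      | smul c y _ hy => rw [smul_algebra_smul_comm]; exact Submodule.smul_mem _ _ hy
    rw [List.map_cons, List.prod_cons, mul_smul, ← mul_smul]
    by_cases hij : i = j
    · subst hij
      have hw := F_prod_smul_mem_weightSpace hx.mem_weightSpace w
      have hmem : (w.map U.F).prod • x ∈
          Submodule.span BaseField (Set.range fun w : List ℤ => (w.map U.F).prod • x) :=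
        Submodule.subset_span ⟨w, rfl⟩
      rw [U.E_mul_F, add_smul, mul_smul, smul_assoc, sub_smul, mul_smul, mul_smul,
        Kinv_smul_of_mem_weightSpace hw, Kinv_smul_of_mem_weightSpace hw, smul_algebra_smul_comm,
        smul_algebra_smul_comm, hw, hw]
      refine Submodule.add_mem _ (hF _ ih) (Submodule.smul_mem _ _ (Submodule.sub_mem _ ?_ ?_)) <;>
      exact Submodule.smul_mem _ _ (Submodule.smul_mem _ _ hmem)
    · rw [U.E_mul_F_of_ne hij, mul_smul]
      exact hF _ ih

lemma span_F_prod (hx : IsHighestWeightVector lam x) (hspan : Submodule.span U {x} = ⊤) :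
    Submodule.span BaseField (Set.range fun w : List ℤ => (w.map U.F).prod • x) = ⊤ := by
  set P := Submodule.span BaseField (Set.range fun w : List ℤ => (w.map U.F).prod • x) with hP
  have of_words : ∀ u : U, (∀ w : List ℤ, u • (w.map U.F).prod • x ∈ P) →
      ∀ y ∈ P, u • y ∈ P := by
    intro u hu y hy
    rw [hP] at hy
    induction hy using Submodule.span_induction with
    | mem y hy => obtain ⟨w, rfl⟩ := hy; exact hu w
    | zero => simp
    | add y z _ _ hy hz => rw [smul_add]; exact Submodule.add_mem _ hy hz
    | smul c y _ hy => rw [smul_algebra_smul_comm]; exact Submodule.smul_mem _ _ hy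
  have stable : ∀ u : U, ∀ y ∈ P, u • y ∈ P := by
    intro u
    have hmem : ∀ w : List ℤ, (w.map U.F).prod • x ∈ P := fun w => Submodule.subset_span ⟨w, rfl⟩
    induction u using U.induction with
    | algebraMap c => intro y hy; rw [algebraMap_smul]; exact P.smul_mem _ hy
    | E i => exact of_words _ (hx.E_smul_F_prod_mem i)
    | F i => exact of_words _ fun w => Submodule.subset_span ⟨i :: w, by simp [mul_smul]⟩
    | K i =>
      refine of_words _ fun w => ?_
      rw [F_prod_smul_mem_weightSpace hx.mem_weightSpace w i]
      exact P.smul_mem _ (hmem w)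
    | Kinv i =>
      refine of_words _ fun w => ?_
      rw [Kinv_smul_of_mem_weightSpace (F_prod_smul_mem_weightSpace hx.mem_weightSpace w) i]
      exact P.smul_mem _ (hmem w)
    | mul a b ha hb => intro y hy; rw [mul_smul]; exact ha _ (hb _ hy)
    | add a b ha hb => intro y hy; rw [add_smul]; exact P.add_mem (ha _ hy) (hb _ hy)
  rw [eq_top_iff]
  intro y _
  have hy : y ∈ Submodule.span U {x} := by rw [hspan]; trivial
  obtain ⟨u, rfl⟩ := Submodule.mem_span_singleton.mp hy
  exact stable u x (Submodule.subset_span ⟨[], by simp⟩)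

lemma iSup_wordSpan (hx : IsHighestWeightVector lam x) (hspan : Submodule.span U {x} = ⊤) :
    ⨆ μ, wordSpan x (lam - μ) = ⊤ := by
  rw [eq_top_iff, ← hx.span_F_prod hspan, Submodule.span_le]
  rintro _ ⟨w, rfl⟩
  exact Submodule.mem_iSup_of_mem (lam - wordWeight w)
    (Submodule.subset_span ⟨w, (sub_sub_cancel _ _).symm, rfl⟩)

lemma iSup_weightSpace (hx : IsHighestWeightVector lam x) (hspan : Submodule.span U {x} = ⊤) :
    ⨆ μ, weightSpace M μ = ⊤ :=
  eq_top_iff.mpr ((hx.iSup_wordSpan hspan).ge.trans (iSup_mono hx.wordSpan_le))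

lemma weightSpace_eq_wordSpan (hx : IsHighestWeightVector lam x)
    (hspan : Submodule.span U {x} = ⊤) (μ : Weight) :
    weightSpace M μ = wordSpan x (lam - μ) := by
  refine le_antisymm ?_ (hx.wordSpan_le μ)
  have htop : wordSpan x (lam - μ) ⊔ ⨆ ν, ⨆ (_ : ν ≠ μ), weightSpace M ν = ⊤ := by
    rw [eq_top_iff, ← hx.iSup_wordSpan hspan]
    refine iSup_le fun ν => ?_
    by_cases hν : ν = μ
    · rw [hν]; exact le_sup_left
    · exact (hx.wordSpan_le ν).trans (le_sup_of_le_right (le_iSup₂_of_le ν hν le_rfl))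
  -- By the modular law, the weight space is the word span plus its intersection with the sum of the
  -- other weight spaces, and that intersection is zero.
  have hmod := sup_inf_assoc_of_le (⨆ ν, ⨆ (_ : ν ≠ μ), weightSpace M ν) (hx.wordSpan_le μ)
  rw [htop, top_inf_eq, inf_comm, (iSupIndep_weightSpace (M := M) μ).eq_bot, sup_bot_eq] at hmod
  exact hmod.le

lemma weights_le (hx : IsHighestWeightVector lam x) (hspan : Submodule.span U {x} = ⊤)
    {μ : Weight} (hμ : μ ∈ weights M) : WtLE μ lam := by
  rw [wtLE_iff]
  by_contra hne
  refine hμ ?_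
  have : {w : List ℤ | wordWeight w = lam - μ} = ∅ :=
    Set.eq_empty_of_forall_notMem fun w hw => hne ⟨w, hw⟩
  rw [hx.weightSpace_eq_wordSpan hspan, wordSpan, this, Set.image_empty, Submodule.span_empty]

lemma isO (hx : IsHighestWeightVector lam x) (hspan : Submodule.span U {x} = ⊤) : IsO M := by
  refine ⟨isWeightModule_iff.mpr (hx.iSup_weightSpace hspan), fun μ => ?_, {lam}, fun μ hμ =>
    ⟨lam, Finset.mem_singleton_self _, hx.weights_le hspan hμ⟩⟩
  rw [hx.weightSpace_eq_wordSpan hspan]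
  exact finiteDimensional_wordSpan _ _

/-- Proper submodules of a highest weight module avoid the highest weight space. -/
lemma le_of_ne_top (hx : IsHighestWeightVector lam x) (hspan : Submodule.span U {x} = ⊤)
    {N : Submodule U M} (hN : N ≠ ⊤) {y : M} (hy : y ∈ N) :
    y ∈ ⨆ ν, ⨆ (_ : ν ≠ lam), weightSpace M ν := by
  have hytop : y ∈ weightSpace M lam ⊔ ⨆ ν, ⨆ (_ : ν ≠ lam), weightSpace M ν := by
    rw [← iSup_split_single, hx.iSup_weightSpace hspan]; trivial
  obtain ⟨a, ha, b, hb, rfl⟩ := Submodule.mem_sup.mp hytop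
  have haN := mem_of_add_mem N ha hb hy
  rw [hx.weightSpace_eq_wordSpan hspan, sub_self, wordSpan_zero] at ha
  obtain ⟨c, rfl⟩ := Submodule.mem_span_singleton.mp ha
  by_cases hc : c = 0
  · rwa [hc, zero_smul, zero_add]
  · exfalso
    refine hN (eq_top_iff.mpr ?_)
    rw [← hspan, Submodule.span_singleton_le_iff_mem]
    have := N.smul_mem (algebraMap BaseField U c⁻¹) haN
    rwa [algebraMap_smul, smul_smul, inv_mul_cancel₀ hc, one_smul] at this

/-- Every proper submodule lies in the sum of the weight spaces other than that of `lam`. This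
linear subspace is closed under sums and misses `x`. -/
lemma sSup_ne_top (hx : IsHighestWeightVector lam x) (hspan : Submodule.span U {x} = ⊤)
    (h0 : x ≠ 0) : sSup {N : Submodule U M | N ≠ ⊤} ≠ ⊤ := by
  intro htop
  have hmem : x ∈ sSup {N : Submodule U M | N ≠ ⊤} := by rw [htop]; trivial
  have key : ∀ z ∈ sSup {N : Submodule U M | N ≠ ⊤},
      z ∈ ⨆ ν, ⨆ (_ : ν ≠ lam), weightSpace M ν := by
    intro z hz
    rw [sSup_eq_iSup'] at hz
    induction hz using Submodule.iSup_induction' with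
    | mem N y hy => exact hx.le_of_ne_top hspan N.2 hy
    | zero => exact Submodule.zero_mem _
    | add y z _ _ hy hz => exact Submodule.add_mem _ hy hz
  exact h0 (Submodule.disjoint_def.mp (iSupIndep_weightSpace (M := M) lam) x hx.mem_weightSpace
    (key x hmem))

end IsHighestWeightVector

end Modules

/-! ### Commutators with Serre elements -/

/-- The `υ`-integer `[n]`. -/
def qInt (n : ℤ) : BaseField := (ups - ups⁻¹)⁻¹ * (ups ^ n - ups ^ (-n))

lemma qInt_neg (n : ℤ) : qInt (-n) = -qInt n := by
  rw [qInt, qInt, neg_neg]; ring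

lemma qInt_add_one_add_qInt_sub_one (n : ℤ) :
    qInt (n + 1) + qInt (n - 1) = (ups + ups⁻¹) * qInt n := by
  have := ups_ne_zero
  simp only [qInt, neg_add, neg_sub', zpow_add₀ ups_ne_zero, zpow_sub₀ ups_ne_zero, zpow_one,
    zpow_neg]
  field_simp
  ring

section Serre

variable {k V : Type*} [Field k] [AddCommGroup V] [Module k V] (c : k)
  (A B D H : Module.End k V)

/-- The Serre element of two operators, with middle coefficient `c`. -/
def serre : Module.End k V := A ^ 2 * B - c • (A * B * A) + B * A ^ 2

lemma serre_apply (x : V) :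
    serre c A B x = A (A (B x)) - c • A (B (A x)) + B (A (A x)) := by
  simp [serre, pow_two, Module.End.mul_apply]

variable {c A B D H}

lemma serre_comm_of_commute (hA : ∀ y, D (A y) = A (D y)) (hB : ∀ y, D (B y) = B (D y)) (x : V) :
    D (serre c A B x) = serre c A B (D x) := by
  simp only [serre_apply, map_add, map_sub, map_smul, hA, hB]

/-- Moving `D` through the Serre element leaves multiples of `A (B x)` and `B (A x)` only; `e1` and
`e2` say that their coefficients vanish. -/
lemma serre_comm_left (hA : ∀ y, D (A y) = A (D y) + H y) (hB : ∀ y, D (B y) = B (D y)) {x : V}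
    {p q r s : k} (h0 : H x = p • x) (h1 : H (A x) = q • A x)
    (h2 : H (B x) = r • B x) (h3 : H (A (B x)) = s • A (B x))
    (h4 : H (B (A x)) = s • B (A x)) (e1 : r + s = c * p) (e2 : p + q = c * s) :
    D (serre c A B x) = serre c A B (D x) := by
  simp only [serre_apply, map_add, map_sub, map_smul, hA, hB, h0, h1, h2, h3, h4]
  linear_combination (norm := module) e1 • A (B x) + e2 • B (A x)

lemma serre_comm_right (hA : ∀ y, D (A y) = A (D y)) (hB : ∀ y, D (B y) = B (D y) + H y) {x : V}
    {p q r : k} (h0 : H x = p • x) (h1 : H (A x) = q • A x)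
    (h2 : H (A (A x)) = r • A (A x)) (e : r + p = c * q) :
    D (serre c A B x) = serre c A B (D x) := by
  simp only [serre_apply, map_add, map_sub, map_smul, hA, hB, h0, h1, h2]
  linear_combination (norm := module) e • A (A x)

end Serre

/-! ### A module over the free algebra with basis the words in the `F i` -/

/-- The space with basis the words in the `F i`. -/
abbrev WordModule : Type := List ℤ →₀ BaseField

namespace WordModule

/-- The operator of left multiplication by the letter `i`. -/
def opF (i : ℤ) : Module.End BaseField WordModule := Finsupp.lmapDomain _ _ (List.cons i)

@[simp] lemma opF_single (i : ℤ) (w : List ℤ) (c : BaseField) :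
    opF i (Finsupp.single w c) = Finsupp.single (i :: w) c := by
  simp [opF]

lemma opF_apply_nil (j : ℤ) (x : WordModule) : opF j x [] = 0 := by
  rw [opF, Finsupp.lmapDomain_apply]
  exact Finsupp.mapDomain_of_notMem_range _ _ (by simp)

/-- The operator multiplying a word by a scalar that depends on its weight. -/
def grade (g : Weight → BaseField) : Module.End BaseField WordModule :=
  Finsupp.linearCombination BaseField fun w => Finsupp.single w (g (wordWeight w))

@[simp] lemma grade_single (g : Weight → BaseField) (w : List ℤ) (c : BaseField) :
    grade g (Finsupp.single w c) = Finsupp.single w (g (wordWeight w) * c) := by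
  simp [grade, mul_comm]

lemma grade_single_eq_smul (g : Weight → BaseField) (w : List ℤ) (c : BaseField) :
    grade g (Finsupp.single w c) = g (wordWeight w) • Finsupp.single w c := by
  simp

lemma grade_apply (g : Weight → BaseField) (x : WordModule) (w : List ℤ) :
    grade g x w = g (wordWeight w) * x w := by
  induction x using Finsupp.induction_linear with
  | zero => simp
  | add x y hx hy => simp [hx, hy, mul_add]
  | single u c =>
    rw [grade_single, Finsupp.single_apply, Finsupp.single_apply]
    split_ifs with h
    · rw [h]
    · simp

lemma hom_ext {f g : Module.End BaseField WordModule}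
    (h : ∀ w, f (Finsupp.single w 1) = g (Finsupp.single w 1)) : f = g :=
  Finsupp.lhom_ext' fun w => LinearMap.ext_ring (h w)

lemma grade_opF (g : Weight → BaseField) (i : ℤ) (x : WordModule) :
    grade g (opF i x) = opF i (grade (fun β => g (β + simpleRoot i)) x) := by
  have : grade g * opF i = opF i * grade (fun β => g (β + simpleRoot i)) :=
    hom_ext fun w => by simp [Module.End.mul_apply, add_comm]
  exact LinearMap.congr_fun this x

/-! ### The operators `E i` on words and the Serre relations. -/

variable (lam : Weight)

/-- The value of the coroot of index `i` at the weight `lam - β`. -/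
def corootValue (i : ℤ) (β : Weight) : ℤ := (lam - β) i - (lam - β) (i + 1)

lemma corootValue_add (i : ℤ) (β γ : Weight) :
    corootValue lam i (β + γ) = corootValue lam i β - (γ i - γ (i + 1)) := by
  simp only [corootValue, Pi.sub_apply, Pi.add_apply]; ring

lemma corootValue_sub (i : ℤ) (β γ : Weight) :
    corootValue lam i (β - γ) = corootValue lam i β + (γ i - γ (i + 1)) := by
  simp only [corootValue, Pi.sub_apply]; ring

/-- The commutator of `E i` and `F i`. -/
def opH (i : ℤ) : Module.End BaseField WordModule := grade fun β => qInt (corootValue lam i β)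

/-- The value of `E i` on a word. -/
def eWord (i : ℤ) : List ℤ → WordModule
  | [] => 0
  | j :: w => opF j (eWord i w) + if i = j then opH lam i (Finsupp.single w 1) else 0

/-- The operator by which `E i` acts. -/
def opE (i : ℤ) : Module.End BaseField WordModule :=
  Finsupp.linearCombination BaseField (eWord lam i)

lemma opE_single (i : ℤ) (w : List ℤ) : opE lam i (Finsupp.single w 1) = eWord lam i w := by
  simp [opE]

@[simp] lemma opE_nil (i : ℤ) (c : BaseField) : opE lam i (Finsupp.single [] c) = 0 := by
  simp [opE, eWord]

lemma opE_opF (i : ℤ) (x : WordModule) :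
    opE lam i (opF i x) = opF i (opE lam i x) + opH lam i x := by
  have : opE lam i * opF i = opF i * opE lam i + opH lam i :=
    hom_ext fun w => by simp [Module.End.mul_apply, opE_single, eWord]
  exact LinearMap.congr_fun this x

lemma opE_opF_of_ne {i j : ℤ} (h : i ≠ j) (x : WordModule) :
    opE lam i (opF j x) = opF j (opE lam i x) := by
  have : opE lam i * opF j = opF j * opE lam i :=
    hom_ext fun w => by simp [Module.End.mul_apply, opE_single, eWord, h]
  exact LinearMap.congr_fun this x

lemma opF_opE (i : ℤ) (x : WordModule) :
    opF i (opE lam i x) = opE lam i (opF i x) + (-opH lam i) x := by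
  rw [opE_opF, LinearMap.neg_apply]; abel

lemma grade_eWord (i : ℤ) (w : List ℤ) : ∀ g : Weight → BaseField,
    grade g (eWord lam i w) = g (wordWeight w - simpleRoot i) • eWord lam i w := by
  induction w with
  | nil => intro g; simp [eWord]
  | cons j w ih =>
    intro g
    rw [eWord, map_add, grade_opF, ih, smul_add, map_smul, wordWeight_cons,
      sub_add_eq_add_sub, add_comm (wordWeight w)]
    congr 1
    split_ifs with h
    · subst h
      rw [opH, grade_single_eq_smul, map_smul, grade_single_eq_smul, smul_comm, add_sub_cancel_left]
    · simp

lemma grade_opE (g : Weight → BaseField) (i : ℤ) (x : WordModule) :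
    grade g (opE lam i x) = opE lam i (grade (fun β => g (β - simpleRoot i)) x) := by
  have : grade g * opE lam i = opE lam i * grade (fun β => g (β - simpleRoot i)) :=
    hom_ext fun w => by
      rw [Module.End.mul_apply, Module.End.mul_apply, opE_single, grade_eWord,
        grade_single_eq_smul, map_smul, opE_single]
  exact LinearMap.congr_fun this x

/-- An operator commuting with all `F i` and killing the empty word vanishes. -/
lemma eq_zero_of_comm_opF {T : Module.End BaseField WordModule}
    (hT : ∀ i w, opF i (T (Finsupp.single w 1)) = T (opF i (Finsupp.single w 1)))
    (h0 : T (Finsupp.single [] 1) = 0) : T = 0 := by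
  refine hom_ext fun w => ?_
  induction w with
  | nil => simpa using h0
  | cons i w ih => rw [← opF_single, ← hT, ih]; simp

lemma simpleRoot_coroot (i j : ℤ) : simpleRoot j i - simpleRoot j (i + 1) =
    2 * delta i j - delta i (j + 1) - delta i (j - 1) := by
  simp only [simpleRoot_apply, delta]
  split_ifs <;> omega

lemma coroot_self (i : ℤ) : simpleRoot i i - simpleRoot i (i + 1) = 2 := by
  simp [simpleRoot_apply, delta]

lemma coroot_of_far {i j : ℤ} (h : 1 < |i - j|) : simpleRoot j i - simpleRoot j (i + 1) = 0 := by
  rw [lt_abs] at h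
  rw [simpleRoot_coroot]; simp only [delta]
  split_ifs <;> omega

lemma coroot_of_adj {i j : ℤ} (h : |i - j| = 1) :
    simpleRoot j i - simpleRoot j (i + 1) = -1 := by
  rw [abs_eq zero_le_one] at h
  rw [simpleRoot_coroot]; simp only [delta]
  split_ifs <;> omega

lemma ne_of_far {i j : ℤ} (h : 1 < |i - j|) : i ≠ j := by
  rintro rfl; simp at h

lemma ne_of_adj {i j : ℤ} (h : |i - j| = 1) : i ≠ j := by
  rintro rfl; simp at h

/-- A Cartan term arises only when `k` is `i` or `j`, and it commutes with the other letter because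
distant roots are orthogonal. -/
lemma opE_comm_opF_comm {i j : ℤ} (h : 1 < |i - j|) (k : ℤ) (x : WordModule) :
    opE lam k ((opF i * opF j - opF j * opF i) x) =
      (opF i * opF j - opF j * opF i) (opE lam k x) := by
  have hne := ne_of_far h
  have hi : corootValue lam i = fun β => corootValue lam i (β + simpleRoot j) := by
    funext β; rw [corootValue_add, coroot_of_far h, sub_zero]
  have hj : corootValue lam j = fun β => corootValue lam j (β + simpleRoot i) := by
    funext β; rw [corootValue_add, coroot_of_far (abs_sub_comm i j ▸ h), sub_zero]
  have hHi : ∀ y, opH lam i (opF j y) = opF j (opH lam i y) := fun y => by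
    rw [opH, grade_opF]; conv_rhs => rw [hi]
  have hHj : ∀ y, opH lam j (opF i y) = opF i (opH lam j y) := fun y => by
    rw [opH, grade_opF]; conv_rhs => rw [hj]
  simp only [LinearMap.sub_apply, Module.End.mul_apply, map_sub]
  by_cases hki : k = i
  · subst hki
    rw [opE_opF, opE_opF_of_ne _ hne, opE_opF_of_ne _ hne, opE_opF, map_add, hHi]
    abel
  by_cases hkj : k = j
  · subst hkj
    rw [opE_opF, opE_opF_of_ne _ hki, opE_opF_of_ne _ hki, opE_opF, map_add, hHj]
    abel
  · simp only [opE_opF_of_ne _ hki, opE_opF_of_ne _ hkj]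

lemma opE_serre_opF {i j : ℤ} (h : |i - j| = 1) (k : ℤ) (x : WordModule) :
    opE lam k (serre (ups + ups⁻¹) (opF i) (opF j) x) =
      serre (ups + ups⁻¹) (opF i) (opF j) (opE lam k x) := by
  have hne := ne_of_adj h
  suffices H : opE lam k * serre (ups + ups⁻¹) (opF i) (opF j) =
      serre (ups + ups⁻¹) (opF i) (opF j) * opE lam k from
    LinearMap.congr_fun H x
  refine hom_ext fun w => ?_
  rw [Module.End.mul_apply, Module.End.mul_apply]
  have hH : ∀ (l : ℤ) (u : List ℤ) (n : ℤ), corootValue lam l (wordWeight u) = n →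
      opH lam l (Finsupp.single u 1) = qInt n • Finsupp.single u 1 := by
    rintro l u n rfl; rw [opH, grade_single_eq_smul]
  have hj := coroot_of_adj h
  have hi := coroot_of_adj (abs_sub_comm i j ▸ h)
  by_cases hki : k = i
  · subst hki
    -- Adding the letter `k` lowers the coroot value by 2 and adding `j` raises it by 1; this gives
    -- the indices `n - 2`, `n + 1` and `n - 1`.
    let n := corootValue lam k (wordWeight w)
    have hs := coroot_self k
    refine serre_comm_left (H := opH lam k) (opE_opF lam k) (opE_opF_of_ne lam hne)
      (hH _ _ n rfl) (q := qInt (n - 2)) (r := qInt (n + 1)) (s := qInt (n - 1)) ?_ ?_ ?_ ?_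
      (qInt_add_one_add_qInt_sub_one n)
      (by convert qInt_add_one_add_qInt_sub_one (n - 1) using 3 <;> ring) <;>
    · simp only [opF_single]
      refine hH _ _ _ ?_
      simp only [n, wordWeight_cons, corootValue, Pi.add_apply, Pi.sub_apply]
      omega
  by_cases hkj : k = j
  · subst hkj
    let n := corootValue lam k (wordWeight w)
    refine serre_comm_right (H := opH lam k) (opE_opF_of_ne lam hki) (opE_opF lam k)
      (hH _ _ n rfl) (q := qInt (n + 1)) (r := qInt (n + 2)) ?_ ?_
      (by convert qInt_add_one_add_qInt_sub_one (n + 1) using 3 <;> ring) <;>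
    · simp only [opF_single]
      refine hH _ _ _ ?_
      simp only [n, wordWeight_cons, corootValue, Pi.add_apply, Pi.sub_apply]
      omega
  · exact serre_comm_of_commute (opE_opF_of_ne lam hki) (opE_opF_of_ne lam hkj) _

lemma opE_comm {i j : ℤ} (h : 1 < |i - j|) : opE lam i * opE lam j = opE lam j * opE lam i := by
  have hne := ne_of_far h
  have hi : corootValue lam i = fun β => corootValue lam i (β - simpleRoot j) := by
    funext β; rw [corootValue_sub, coroot_of_far h, add_zero]
  have hj : corootValue lam j = fun β => corootValue lam j (β - simpleRoot i) := by
    funext β; rw [corootValue_sub, coroot_of_far (abs_sub_comm i j ▸ h), add_zero]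
  have hHi : ∀ y, opH lam i (opE lam j y) = opE lam j (opH lam i y) := fun y => by
    rw [opH, grade_opE]; conv_rhs => rw [hi]
  have hHj : ∀ y, opH lam j (opE lam i y) = opE lam i (opH lam j y) := fun y => by
    rw [opH, grade_opE]; conv_rhs => rw [hj]
  rw [← sub_eq_zero]
  refine eq_zero_of_comm_opF (fun k w => ?_) (by simp [Module.End.mul_apply])
  simp only [LinearMap.sub_apply, Module.End.mul_apply, map_sub]
  generalize Finsupp.single w (1 : BaseField) = x
  by_cases hki : k = i
  · subst hki
    simp only [opE_opF_of_ne _ hne.symm, opE_opF, map_add, hHi]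
    abel
  by_cases hkj : k = j
  · subst hkj
    simp only [opE_opF_of_ne _ hne, opE_opF, map_add, hHj]
    abel
  · simp only [opE_opF_of_ne _ (Ne.symm hki), opE_opF_of_ne _ (Ne.symm hkj)]

lemma serre_opE {i j : ℤ} (h : |i - j| = 1) : serre (ups + ups⁻¹) (opE lam i) (opE lam j) = 0 := by
  have hne := ne_of_adj h
  refine eq_zero_of_comm_opF (fun k w => ?_) (by simp [serre_apply])
  have hH : ∀ (l : ℤ) (n : ℤ), corootValue lam l (wordWeight w) = -n →
      (-opH lam l) (Finsupp.single w 1) = qInt n • Finsupp.single w 1 := by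
    intro l n hn
    rw [LinearMap.neg_apply, opH, grade_single_eq_smul, hn, qInt_neg, neg_smul, neg_neg]
  have hH1 : ∀ (l : ℤ) (n : ℤ) (a : ℤ), corootValue lam l (wordWeight w - simpleRoot a) = -n →
      (-opH lam l) (opE lam a (Finsupp.single w 1)) =
        qInt n • opE lam a (Finsupp.single w 1) := by
    intro l n a hn
    rw [LinearMap.neg_apply, opH, grade_opE, grade_single_eq_smul, hn, qInt_neg, map_smul,
      neg_smul, neg_neg]
  have hH2 : ∀ (l : ℤ) (n : ℤ) (a b : ℤ),
      corootValue lam l (wordWeight w - simpleRoot b - simpleRoot a) = -n →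
      (-opH lam l) (opE lam a (opE lam b (Finsupp.single w 1))) =
        qInt n • opE lam a (opE lam b (Finsupp.single w 1)) := by
    intro l n a b hn
    rw [LinearMap.neg_apply, opH, grade_opE, grade_opE, grade_single_eq_smul, hn, qInt_neg,
      map_smul, map_smul, neg_smul, neg_neg]
  have hj := coroot_of_adj h
  have hi := coroot_of_adj (abs_sub_comm i j ▸ h)
  by_cases hki : k = i
  · subst hki
    -- The roles of `E` and `F` are exchanged, so the Cartan term is `-opH`. The sign in `n` makes
    -- it act by `[n]`, as `[-n] = -[n]`.
    let n := -corootValue lam k (wordWeight w)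
    have hs := coroot_self k
    refine serre_comm_left (H := -opH lam k) (opF_opE lam k)
      (fun y => (opE_opF_of_ne lam hne.symm y).symm) (hH _ n (neg_neg _).symm)
      (hH1 _ (n - 2) _ ?_) (hH1 _ (n + 1) _ ?_) (hH2 _ (n - 1) _ _ ?_) (hH2 _ (n - 1) _ _ ?_)
      (qInt_add_one_add_qInt_sub_one n)
      (by convert qInt_add_one_add_qInt_sub_one (n - 1) using 3 <;> ring) <;>
    · simp only [n, corootValue, Pi.sub_apply]
      omega
  by_cases hkj : k = j
  · subst hkj
    let n := -corootValue lam k (wordWeight w)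
    refine serre_comm_right (H := -opH lam k)
      (fun y => (opE_opF_of_ne lam hne y).symm) (opF_opE lam k) (hH _ n (neg_neg _).symm)
      (hH1 _ (n + 1) _ ?_) (hH2 _ (n + 2) _ _ ?_)
      (by convert qInt_add_one_add_qInt_sub_one (n + 1) using 3 <;> ring) <;>
    · simp only [n, corootValue, Pi.sub_apply]
      omega
  · exact serre_comm_of_commute (fun y => (opE_opF_of_ne lam (Ne.symm hki) y).symm)
      (fun y => (opE_opF_of_ne lam (Ne.symm hkj) y).symm) _

/-! ### The radical of the word module -/

/-- The vectors from which no word in the `E i` leads back to the empty word. -/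
def radical : Submodule BaseField WordModule where
  carrier := {x | ∀ w : List ℤ, ((w.map (opE lam)).prod x) [] = 0}
  zero_mem' := fun w => by simp
  add_mem' := fun hx hy w => by rw [map_add, Finsupp.add_apply, hx w, hy w, add_zero]
  smul_mem' := fun c x hx w => by rw [map_smul, Finsupp.smul_apply, hx w, smul_zero]

variable {lam}

lemma mem_radical {x : WordModule} :
    x ∈ radical lam ↔ ∀ w : List ℤ, ((w.map (opE lam)).prod x) [] = 0 := Iff.rfl

lemma opE_mem_radical (i : ℤ) {x : WordModule} (hx : x ∈ radical lam) :
    opE lam i x ∈ radical lam := fun w => by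
  have := hx (w ++ [i])
  rwa [List.map_append, List.prod_append, List.map_singleton, List.prod_singleton] at this

/-- A grading operator passes through a word in the `E i` at the cost of shifting `g`, and then only
rescales the coefficient of the empty word. -/
lemma grade_mem_radical (g : Weight → BaseField) {x : WordModule} (hx : x ∈ radical lam) :
    grade g x ∈ radical lam := by
  intro w
  have : ∀ g : Weight → BaseField, ∃ g', ∀ y, (w.map (opE lam)).prod (grade g y) =
      grade g' ((w.map (opE lam)).prod y) := by
    induction w with
    | nil => exact fun g => ⟨g, fun y => rfl⟩
    | cons i w ih =>
      intro g
      obtain ⟨g', hg'⟩ := ih g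
      refine ⟨fun β => g' (β + simpleRoot i), fun y => ?_⟩
      rw [List.map_cons, List.prod_cons, Module.End.mul_apply, hg', Module.End.mul_apply,
        grade_opE]
      simp only [sub_add_cancel]
  obtain ⟨g', hg'⟩ := this g
  rw [hg', grade_apply, hx w, mul_zero]

/-- The letter of the `E`-word that acts first is moved past `F j`; both resulting terms come from
vectors of the radical. The empty `E`-word causes no trouble, since `F j` never produces the empty
word. -/
lemma opF_mem_radical (j : ℤ) {x : WordModule} (hx : x ∈ radical lam) :
    opF j x ∈ radical lam := by
  intro w
  induction w using List.reverseRecOn generalizing x with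
  | nil =>
    rw [List.map_nil, List.prod_nil, Module.End.one_apply, opF_apply_nil]
  | append_singleton w i ih =>
    rw [List.map_append, List.prod_append, List.map_singleton, List.prod_singleton,
      Module.End.mul_apply]
    by_cases hij : i = j
    · subst hij
      rw [opE_opF, map_add, Finsupp.add_apply, ih (opE_mem_radical i hx), opH,
        grade_mem_radical _ hx w, add_zero]
    · rw [opE_opF_of_ne _ hij, ih (opE_mem_radical i hx)]

/-- `T` moves past every word in the `E i`, and its values have no component on the empty word. This
serves for the relations among the `F i`, which fail on the word module itself. -/
lemma mem_radical_of_comm_opE {T : Module.End BaseField WordModule}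
    (hT : ∀ i y, opE lam i (T y) = T (opE lam i y)) (h0 : ∀ y, T y [] = 0) (x : WordModule) :
    T x ∈ radical lam := by
  intro w
  have : ∀ y, (w.map (opE lam)).prod (T y) = T ((w.map (opE lam)).prod y) := by
    induction w with
    | nil => exact fun y => rfl
    | cons i w ih =>
      intro y
      rw [List.map_cons, List.prod_cons, Module.End.mul_apply, ih, hT, Module.End.mul_apply]
  rw [this, h0]

lemma comm_opF_mem_radical {i j : ℤ} (h : 1 < |i - j|) (x : WordModule) :
    opF i (opF j x) - opF j (opF i x) ∈ radical lam :=
  mem_radical_of_comm_opE (T := opF i * opF j - opF j * opF i) (opE_comm_opF_comm lam h)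
    (fun y => by simp [opF_apply_nil, Module.End.mul_apply]) x

lemma serre_opF_mem_radical {i j : ℤ} (h : |i - j| = 1) (x : WordModule) :
    serre (ups + ups⁻¹) (opF i) (opF j) x ∈ radical lam :=
  mem_radical_of_comm_opE (opE_serre_opF lam h)
    (fun y => by simp [serre_apply, opF_apply_nil]) x

/-! ### The action of `U(∞)` on the quotient by the radical. -/

variable (lam)

/-- The operators by which the generators act on the word module. -/
def genAct : Gen → Module.End BaseField WordModule
  | .E i => opE lam i
  | .F i => opF i
  | .K i => grade fun β => ups ^ (lam - β) i
  | .Kinv i => grade fun β => ups ^ (-(lam - β) i)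

lemma radical_le_comap_genAct (g : Gen) :
    radical lam ≤ (radical lam).comap (genAct lam g) := by
  intro x hx
  rw [Submodule.mem_comap]
  cases g with
  | E i => exact opE_mem_radical i hx
  | F i => exact opF_mem_radical i hx
  | K i => rw [genAct]; exact grade_mem_radical _ hx
  | Kinv i => rw [genAct]; exact grade_mem_radical _ hx

/-- The quotient of the word module by its radical. -/
abbrev WordQuotient : Type := WordModule ⧸ radical lam

/-- The action of the free algebra on the quotient of the word module by its radical. -/
def freeAct : FreeAlg →ₐ[BaseField] Module.End BaseField (WordQuotient lam) :=
  FreeAlgebra.lift BaseField fun g =>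
    (radical lam).mapQ (radical lam) (genAct lam g) (radical_le_comap_genAct lam g)

lemma freeAct_E (i : ℤ) (x : WordModule) :
    freeAct lam (FreeAlg.E i) ((radical lam).mkQ x) = (radical lam).mkQ (opE lam i x) := by
  simp [freeAct, FreeAlg.E, genAct]

lemma freeAct_F (i : ℤ) (x : WordModule) :
    freeAct lam (FreeAlg.F i) ((radical lam).mkQ x) = (radical lam).mkQ (opF i x) := by
  simp [freeAct, FreeAlg.F, genAct]

lemma freeAct_K (i : ℤ) (x : WordModule) :
    freeAct lam (FreeAlg.K i) ((radical lam).mkQ x) =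
      (radical lam).mkQ (grade (fun β => ups ^ (lam - β) i) x) := by
  simp [freeAct, FreeAlg.K, genAct]

lemma freeAct_Kinv (i : ℤ) (x : WordModule) :
    freeAct lam (FreeAlg.Kinv i) ((radical lam).mkQ x) =
      (radical lam).mkQ (grade (fun β => ups ^ (-(lam - β) i)) x) := by
  simp [freeAct, FreeAlg.Kinv, genAct]

lemma quot_hom_ext {f g : Module.End BaseField (WordQuotient lam)}
    (h : ∀ w, f ((radical lam).mkQ (Finsupp.single w 1)) =
      g ((radical lam).mkQ (Finsupp.single w 1))) : f = g :=
  Submodule.linearMap_qext _ (Finsupp.lhom_ext' fun w => LinearMap.ext_ring (h w))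

lemma freeAct_rel {a b : FreeAlg} (h : Rel a b) : freeAct lam a = freeAct lam b := by
  refine quot_hom_ext lam fun w => ?_
  cases h with
  | K_comm i j =>
    simp only [map_mul, Module.End.mul_apply, freeAct_K, grade_single_eq_smul, map_smul]
    rw [smul_comm]
  | K_mul_Kinv i =>
    simp only [map_mul, map_one, Module.End.mul_apply, Module.End.one_apply, freeAct_K,
      freeAct_Kinv, grade_single_eq_smul, map_smul]
    rw [smul_smul, ← zpow_add₀ ups_ne_zero, neg_add_cancel, zpow_zero, one_smul]
  | Kinv_mul_K i =>
    simp only [map_mul, map_one, Module.End.mul_apply, Module.End.one_apply, freeAct_K,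
      freeAct_Kinv, grade_single_eq_smul, map_smul]
    rw [smul_smul, ← zpow_add₀ ups_ne_zero, add_neg_cancel, zpow_zero, one_smul]
  | K_E i j =>
    simp only [map_mul, map_smul, LinearMap.smul_apply, Module.End.mul_apply, freeAct_K,
      freeAct_E, grade_opE, grade_single_eq_smul]
    rw [smul_smul, ← zpow_add₀ ups_ne_zero, ← simpleRoot_apply]
    congr 2
    simp only [Pi.sub_apply]; ring
  | K_F i j =>
    simp only [map_mul, map_smul, LinearMap.smul_apply, Module.End.mul_apply, freeAct_K,
      freeAct_F, grade_opF, grade_single_eq_smul]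
    rw [smul_smul, ← zpow_add₀ ups_ne_zero, ← neg_sub (delta i j), ← simpleRoot_apply]
    congr 2
    simp only [Pi.sub_apply, Pi.add_apply]; ring
  | E_comm i j h =>
    simp only [map_mul, Module.End.mul_apply, freeAct_E]
    exact congrArg _ (LinearMap.congr_fun (opE_comm lam h) _)
  | F_comm i j h =>
    simp only [map_mul, Module.End.mul_apply, freeAct_F]
    exact (Submodule.Quotient.eq _).mpr (comm_opF_mem_radical h _)
  | E_F i =>
    simp only [map_mul, map_sub, map_smul, LinearMap.smul_apply, LinearMap.sub_apply,
      Module.End.mul_apply, freeAct_E, freeAct_F, freeAct_K, freeAct_Kinv, grade_single_eq_smul]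
    rw [opE_opF, map_add, add_sub_cancel_left, opH, grade_single_eq_smul, map_smul, smul_smul,
      smul_smul, ← sub_smul, smul_smul, qInt, corootValue, ← zpow_add₀ ups_ne_zero,
      ← zpow_add₀ ups_ne_zero]
    congr 3
    · congr 1; ring
    · congr 1; ring
  | E_F_ne i j h =>
    simp only [map_mul, map_sub, map_zero, LinearMap.zero_apply, LinearMap.sub_apply,
      Module.End.mul_apply, freeAct_E, freeAct_F]
    rw [opE_opF_of_ne _ h, sub_self]
  | E_serre i j h =>
    have := congrArg (radical lam).mkQ
      (LinearMap.congr_fun (serre_opE lam h) (Finsupp.single w 1))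
    simpa only [pow_two, map_add, map_mul, map_sub, map_smul, map_zero, LinearMap.zero_apply,
      LinearMap.sub_apply, LinearMap.add_apply, LinearMap.smul_apply, Module.End.mul_apply,
      freeAct_E, serre_apply] using this
  | F_serre i j h =>
    have := (Submodule.Quotient.mk_eq_zero _).mpr
      (serre_opF_mem_radical (lam := lam) h (Finsupp.single w 1))
    rw [← Submodule.mkQ_apply] at this
    simpa only [pow_two, map_add, map_mul, map_sub, map_smul, map_zero, LinearMap.zero_apply,
      LinearMap.sub_apply, LinearMap.add_apply, LinearMap.smul_apply, Module.End.mul_apply,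
      freeAct_F, serre_apply] using this

/-- The action of `U(∞)` on the quotient of the word module by its radical. -/
def act : U →ₐ[BaseField] Module.End BaseField (WordQuotient lam) :=
  RingQuot.liftAlgHom BaseField ⟨freeAct lam, fun _ _ h => freeAct_rel lam h⟩

lemma act_mkAlgHom (a : FreeAlg) :
    act lam (RingQuot.mkAlgHom BaseField Rel a) = freeAct lam a := by
  simp [act]

/-- The class of the empty word. -/
def vacuum : WordQuotient lam := (radical lam).mkQ (Finsupp.single [] 1)

lemma vacuum_ne_zero : vacuum lam ≠ 0 := by
  intro h
  have := (Submodule.Quotient.mk_eq_zero _).mp h []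
  simp at this

lemma act_vacuum_eq_zero {u : U} (hu : u ∈ vermaIdeal lam) : act lam u (vacuum lam) = 0 := by
  induction hu using Submodule.span_induction with
  | mem u hu =>
    rcases hu with ⟨i, rfl⟩ | ⟨i, rfl⟩
    · rw [U.E, act_mkAlgHom, vacuum, freeAct_E, opE_nil, map_zero]
    · rw [map_sub, U.K, act_mkAlgHom, AlgHom.commutes, LinearMap.sub_apply, vacuum, freeAct_K,
        grade_single_eq_smul, map_smul, Module.algebraMap_end_apply, wordWeight_nil, sub_zero,
        sub_self]
  | zero => simp
  | add a b _ _ ha hb => rw [map_add, LinearMap.add_apply, ha, hb, add_zero]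
  | smul c a _ ha => rw [smul_eq_mul, map_mul, Module.End.mul_apply, ha, map_zero]

end WordModule

/-- The ideal annihilates the vacuum, whereas `1` fixes it. This is the sole purpose of the word
module. -/
lemma one_notMem_vermaIdeal (lam : Weight) : (1 : U) ∉ vermaIdeal lam := fun h => by
  have := WordModule.act_vacuum_eq_zero lam h
  rw [map_one] at this
  exact WordModule.vacuum_ne_zero lam this

/-! ### Verma modules and irreducible modules of highest weight -/

/-- The generator of the Verma module. -/
def vermaVector (lam : Weight) : Verma lam := (vermaIdeal lam).mkQ 1

lemma smul_vermaVector (lam : Weight) (u : U) :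
    u • vermaVector lam = (vermaIdeal lam).mkQ u := by
  rw [vermaVector, ← map_smul, smul_eq_mul, mul_one]

lemma vermaVector_ne_zero (lam : Weight) : vermaVector lam ≠ 0 := fun h =>
  one_notMem_vermaIdeal lam ((Submodule.Quotient.mk_eq_zero _).mp h)

lemma isHighestWeightVector_vermaVector (lam : Weight) :
    IsHighestWeightVector lam (vermaVector lam) where
  mem_weightSpace i := by
    rw [← algebraMap_smul U (ups ^ lam i) (vermaVector lam), ← sub_eq_zero, ← sub_smul,
      smul_vermaVector]
    exact (Submodule.Quotient.mk_eq_zero _).mpr (Submodule.subset_span (Or.inr ⟨i, rfl⟩))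
  E_smul i := by
    rw [smul_vermaVector]
    exact (Submodule.Quotient.mk_eq_zero _).mpr (Submodule.subset_span (Or.inl ⟨i, rfl⟩))

lemma span_vermaVector (lam : Weight) : Submodule.span U {vermaVector lam} = ⊤ := by
  rw [eq_top_iff]
  intro y _
  obtain ⟨u, rfl⟩ := (vermaIdeal lam).mkQ_surjective y
  exact Submodule.mem_span_singleton.mpr ⟨u, smul_vermaVector lam u⟩

/-- The Verma module has a unique maximal submodule, the sum of its proper submodules. -/
lemma isCoatom_iff_eq_vermaRadical (lam : Weight) (N : Submodule U (Verma lam)) :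
    IsCoatom N ↔ N = vermaRadical lam := by
  have hne : vermaRadical lam ≠ ⊤ :=
    (isHighestWeightVector_vermaVector lam).sSup_ne_top (span_vermaVector lam)
      (vermaVector_ne_zero lam)
  have hle : ∀ N : Submodule U (Verma lam), N ≠ ⊤ → N ≤ vermaRadical lam := fun N hN => le_sSup hN
  constructor
  · intro h
    by_contra hN
    exact hne (h.2 _ (lt_of_le_of_ne (hle N h.1) hN))
  · rintro rfl
    refine ⟨hne, fun N hN => ?_⟩
    by_contra hN'
    exact hN.not_ge (hle N hN')

instance isSimpleModule_LType (lam : Weight) : IsSimpleModule U (LType lam) :=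
  isSimpleModule_iff_isCoatom.mpr ((isCoatom_iff_eq_vermaRadical lam _).mpr rfl)

/-! ### Irreducible modules and highest weight vectors. -/

section Modules

variable {M : Type w} [AddCommGroup M] [Module BaseField M] [Module U M]
  [IsScalarTower BaseField U M]

lemma IsHighestWeightVector.map {M' : Type*} [AddCommGroup M'] [Module BaseField M'] [Module U M']
    [IsScalarTower BaseField U M'] {lam : Weight} {x : M} (hx : IsHighestWeightVector lam x)
    (f : M →ₗ[U] M') : IsHighestWeightVector lam (f x) where
  mem_weightSpace i := by
    rw [← map_smul, hx.mem_weightSpace i, ← algebraMap_smul U (ups ^ lam i) x, map_smul,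
      algebraMap_smul]
  E_smul i := by rw [← map_smul, hx.E_smul, map_zero]

/-- An irreducible module with a highest weight vector of weight `lam` is isomorphic to
`L(lam)`. -/
lemma IsHighestWeightVector.nonempty_equiv [IsSimpleModule U M] {lam : Weight} {x : M}
    (hx : IsHighestWeightVector lam x) (h0 : x ≠ 0) : Nonempty (LType lam ≃ₗ[U] M) := by
  have hle : vermaIdeal lam ≤ LinearMap.ker (LinearMap.toSpanSingleton U M x) := by
    refine Submodule.span_le.mpr ?_
    rintro _ (⟨i, rfl⟩ | ⟨i, rfl⟩)
    · simpa using hx.E_smul i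
    · simp [sub_smul, hx.mem_weightSpace i]
  let f : Verma lam →ₗ[U] M := (vermaIdeal lam).liftQ (LinearMap.toSpanSingleton U M x) hle
  have hf : f (vermaVector lam) = x := by
    simp [f, vermaVector]
  have hf0 : f ≠ 0 := fun h => h0 (by rw [← hf, h, LinearMap.zero_apply])
  have hsurj : Function.Surjective f := LinearMap.surjective_of_ne_zero hf0
  have e := f.quotKerEquivOfSurjective hsurj
  have hker : LinearMap.ker f = vermaRadical lam := by
    rw [← isCoatom_iff_eq_vermaRadical, ← isSimpleModule_iff_isCoatom]
    exact IsSimpleModule.congr e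
  exact ⟨(Submodule.quotEquivOfEq _ _ hker.symm).trans e⟩

/-- Nonzero modules in `C^hi` have highest weight vectors. -/
lemma IsHi.exists_isHighestWeightVector [Nontrivial M] (h : IsHi M) :
    ∃ (lam : Weight) (x : M), IsHighestWeightVector lam x ∧ x ≠ 0 := by
  obtain ⟨μ, hμ⟩ : ∃ μ, weightSpace M μ ≠ ⊥ := by
    by_contra! hbot
    have := isWeightModule_iff.mp h.1
    simp only [hbot, iSup_bot] at this
    exact bot_ne_top this
  obtain ⟨x, hx, h0⟩ := Submodule.exists_mem_ne_zero_of_ne_bot hμ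
  classical
  have hex : ∃ n, ∀ w : List ℤ, n ≤ w.length → (w.map U.E).prod • x = 0 :=
    let ⟨n, _, hn⟩ := h.2 x; ⟨n, hn⟩
  have hpos : Nat.find hex ≠ 0 := fun hz => h0 <| by
    simpa using Nat.find_spec hex [] (by rw [hz]; exact Nat.zero_le _)
  -- By minimality, some word `w` of length at least one less than the bound does not kill `x`; any
  -- further letter brings it to the bound.
  have hmin := Nat.find_min hex (m := Nat.find hex - 1) (by omega)
  push Not at hmin
  obtain ⟨w, hw, hw0⟩ := hmin
  refine ⟨_, _, ⟨E_prod_smul_mem_weightSpace hx w, fun i => ?_⟩, hw0⟩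
  have := Nat.find_spec hex (i :: w) (by rw [List.length_cons]; omega)
  rwa [List.map_cons, List.prod_cons, mul_smul] at this

end Modules

/-! ### The bijections between weights and isomorphism classes. -/

section Categories

open scoped ModuleCat

/-- The projection of the Verma module onto `L(lam)`. -/
def vermaToL (lam : Weight) : Verma lam →ₗ[U] L.{w} lam :=
  (ULift.moduleEquiv.symm : LType lam ≃ₗ[U] ULift.{w} (LType lam)).toLinearMap ∘ₗ
    (vermaRadical lam).mkQ

lemma vermaToL_eq_zero_iff {lam : Weight} {x : Verma lam} :
    vermaToL.{w} lam x = 0 ↔ x ∈ vermaRadical lam :=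
  (LinearEquiv.map_eq_zero_iff
    (ULift.moduleEquiv.symm : LType lam ≃ₗ[U] ULift.{w} (LType lam))).trans
    (Submodule.Quotient.mk_eq_zero _)

/-- The highest weight vector of `L(lam)`. -/
def vectorL (lam : Weight) : L.{w} lam := vermaToL lam (vermaVector lam)

lemma isHighestWeightVector_vectorL (lam : Weight) :
    IsHighestWeightVector lam (vectorL.{w} lam) :=
  (isHighestWeightVector_vermaVector lam).map (vermaToL lam)

instance isSimpleModule_L (lam : Weight) : IsSimpleModule U (L.{w} lam) :=
  IsSimpleModule.congr (ULift.moduleEquiv : ULift.{w} (LType lam) ≃ₗ[U] LType lam)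

lemma vectorL_ne_zero (lam : Weight) : vectorL.{w} lam ≠ 0 := by
  intro h
  refine ((isCoatom_iff_eq_vermaRadical lam _).mpr rfl).1 (eq_top_iff.mpr ?_)
  rw [← span_vermaVector, Submodule.span_singleton_le_iff_mem]
  exact vermaToL_eq_zero_iff.mp h

lemma span_vectorL (lam : Weight) : Submodule.span U {vectorL.{w} lam} = ⊤ :=
  (eq_bot_or_eq_top _).resolve_left fun h =>
    vectorL_ne_zero lam (Submodule.span_singleton_eq_bot.mp h)

lemma isO_L (lam : Weight) : IsO (L.{w} lam) :=
  (isHighestWeightVector_vectorL lam).isO (span_vectorL lam)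

lemma wtLE_of_iso {lam μ : Weight} (e : L.{w} lam ≅ L.{w} μ) : WtLE lam μ := by
  refine (isHighestWeightVector_vectorL μ).weights_le (span_vectorL μ) fun hbot => ?_
  have hv := ((isHighestWeightVector_vectorL lam).map e.toLinearEquiv.toLinearMap).mem_weightSpace
  rw [hbot, Submodule.mem_bot] at hv
  exact vectorL_ne_zero lam (e.toLinearEquiv.map_eq_zero_iff.mp hv)

/-- Both categories lie between the modules `L(lam)` and `C^hi`, which is all the argument uses.
Injectivity holds because isomorphic modules have highest weights that bound each other. -/
lemma bijOn_isoClass_L (P : ObjectProperty (ModuleCat.{w} U)) (hL : ∀ lam, P (L lam))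
    (hP : ∀ M : ModuleCat.{w} U, P M → IsHi M) :
    Set.BijOn (fun lam : Weight => isoClass (L.{w} lam)) Set.univ (irreducibleClasses P) := by
  refine ⟨fun lam _ => ⟨L lam, hL lam, inferInstance, rfl⟩, fun lam _ μ _ h => ?_, ?_⟩
  · obtain ⟨e⟩ : IsIsomorphic (L.{w} lam) (L.{w} μ) := Quotient.exact h
    exact (wtLE_of_iso e).antisymm (wtLE_of_iso e.symm)
  · rintro _ ⟨M, hM, hs, rfl⟩
    have : Nontrivial M := IsSimpleModule.nontrivial U M
    obtain ⟨lam, x, hx, h0⟩ := (hP M hM).exists_isHighestWeightVector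
    obtain ⟨e⟩ := hx.nonempty_equiv h0
    refine ⟨lam, Set.mem_univ _, Quotient.sound ⟨?_⟩⟩
    exact ((ULift.moduleEquiv : ULift.{w} (LType lam) ≃ₗ[U] LType lam).trans e).toModuleIso

/-- The parametrization of the irreducible objects of `C^hi` by highest weights. -/
lemma bijOn_isoClass_L_catHi :
    Set.BijOn (fun lam : Weight => isoClass (L.{w} lam)) Set.univ
      (irreducibleClasses catHi.{w}) :=
  bijOn_isoClass_L _ (fun lam => (isO_L lam).isHi) fun _ h => h

/-- The parametrization of the irreducible objects of `O` by highest weights. -/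
lemma bijOn_isoClass_L_catO :
    Set.BijOn (fun lam : Weight => isoClass (L.{w} lam)) Set.univ
      (irreducibleClasses catO.{w}) :=
  bijOn_isoClass_L _ isO_L fun _ h => IsO.isHi h

end Categories

end

end QuantumGL

theorem mainTheorem7 :
    -- `vermaRadical lam` is the unique maximal submodule of the Verma module, so that
    -- `L lam` is its unique irreducible quotient
    (∀ (lam : QuantumGL.Weight) (N : Submodule QuantumGL.U (QuantumGL.Verma lam)),
      IsCoatom N ↔ N = QuantumGL.vermaRadical lam) ∧
    Set.BijOn (fun lam : QuantumGL.Weight => QuantumGL.isoClass (QuantumGL.L.{w} lam))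
      Set.univ (QuantumGL.irreducibleClasses QuantumGL.catHi.{w}) ∧
    Set.BijOn (fun lam : QuantumGL.Weight => QuantumGL.isoClass (QuantumGL.L.{w} lam))
      Set.univ (QuantumGL.irreducibleClasses QuantumGL.catO.{w}) :=
  ⟨QuantumGL.isCoatom_iff_eq_vermaRadical, QuantumGL.bijOn_isoClass_L_catHi,
    QuantumGL.bijOn_isoClass_L_catO⟩
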